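/- All spaces are Tychonoff (completely regular and Hausdorff). Let $\{Y_\gamma : \gamma\in\Gamma\}$ be a family of first-countable Tychonoff spaces, let $a\in\prod_{\gamma\in\Gamma}Y_\gamma$, and let $$\Sigma\Bigl(\prod_{\gamma\in\Gamma}Y_\gamma,a\Bigr)=\Bigl\{y\in\prod_{\gamma\in\Gamma}Y_\gamma : \{\gamma\in\Gamma : y(\gamma)\neq a(\gamma)\}\text{ is at most countable}\Bigr\},$$ with the subspace topology inherited from the product topology. If $X$ is a subspace of $\Sigma(\prod_{\gamma\in\Gamma}Y_\gamma,a)$ that is Lindelöf (every open cover has a countable subcover) and scattered (every nonempty subset of $X$ has a relative isolated point), then $X$ is $\sigma$-compact, i.e. a countable union of compact subsets. -/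

import Mathlib

open Set Filter Topology

/-- A topological space is scattered if every nonempty subset `A` has a relative isolated point:
some point `x` of `A` has an open neighbourhood in the space that meets `A` only in `x`. -/
def IsScatteredSpace (X : Type*) [TopologicalSpace X] : Prop :=
  ∀ A : Set X, A.Nonempty → ∃ x ∈ A, ∃ U : Set X, IsOpen U ∧ U ∩ A = {x}

/-- The `Σ`-product of the family `Y` based at `a`: the points of the product that differ from `a`
in at most countably many coordinates. -/
def sigmaProduct {Γ : Type*} {Y : Γ → Type*} (a : ∀ γ, Y γ) : Set (∀ γ, Y γ) :=
  {y | {γ | y γ ≠ a γ}.Countable}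

-- Lindelöfness and scatteredness yield countably many finitary operations from coordinates to
-- points of `X` such that, for every coordinate set `A` closed under them, each retract to `A` of a
-- point of `X` is the value of an operation on a finite list in `A`
-- (`finitelyDetermined_of_lindelof_scattered`). So `X` is stable under these retractions, a
-- countable closed `A` supports only countably many points of `X`, and a point supported in the
-- union of a chain of closed sets is already supported in a member of it.
--
-- Induction on the cardinality of `A` then shows that the points of `X` supported in a closed `A`
-- form a σ-compact set (`isSigmaCompact_supportedIn`). An uncountable `A` is the union of a
-- continuous chain of smaller closed sets, and `isCompact_chainCompact` glues their compact
-- exhaustions. The case where `A` is the whole index set is the theorem.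

universe u v

/-! ### Supports and retractions -/

/-- The coordinates in which `x` differs from `a`. -/
def diffSupport {Γ : Type u} {Y : Γ → Type v} (a x : ∀ γ, Y γ) : Set Γ :=
  {γ | x γ ≠ a γ}

/-- The retraction that replaces the coordinates outside `A` by those of `a`. -/
noncomputable def retractTo {Γ : Type u} {Y : Γ → Type v} (a : ∀ γ, Y γ) (A : Set Γ)
    (x : ∀ γ, Y γ) : ∀ γ, Y γ :=
  open Classical in A.piecewise x a

section Retract

variable {Γ : Type u} {Y : Γ → Type v} {a : ∀ γ, Y γ}

theorem retractTo_of_mem {A : Set Γ} {γ : Γ} (h : γ ∈ A) (x : ∀ γ, Y γ) :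
    retractTo a A x γ = x γ := by
  classical
  simp [retractTo, h]

theorem retractTo_of_notMem {A : Set Γ} {γ : Γ} (h : γ ∉ A) (x : ∀ γ, Y γ) :
    retractTo a A x γ = a γ := by
  classical
  simp [retractTo, h]

theorem diffSupport_retractTo_subset (A : Set Γ) (x : ∀ γ, Y γ) :
    diffSupport a (retractTo a A x) ⊆ A := by
  intro γ hγ
  by_contra h
  exact hγ (retractTo_of_notMem h x)

theorem retractTo_eq_self {A : Set Γ} {x : ∀ γ, Y γ} (h : diffSupport a x ⊆ A) :
    retractTo a A x = x := by
  funext γ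
  by_cases hγ : γ ∈ A
  · exact retractTo_of_mem hγ x
  · rw [retractTo_of_notMem hγ]
    by_contra hne
    exact hγ (h (Ne.symm hne))

theorem retractTo_retractTo {A B : Set Γ} (h : A ⊆ B) (x : ∀ γ, Y γ) :
    retractTo a A (retractTo a B x) = retractTo a A x := by
  funext γ
  by_cases hγ : γ ∈ A
  · rw [retractTo_of_mem hγ, retractTo_of_mem hγ, retractTo_of_mem (h hγ)]
  · rw [retractTo_of_notMem hγ, retractTo_of_notMem hγ]

theorem continuous_retractTo [∀ γ, TopologicalSpace (Y γ)] (A : Set Γ) :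
    Continuous (retractTo a A) := by
  refine continuous_pi fun γ => ?_
  by_cases hγ : γ ∈ A
  · simpa only [retractTo_of_mem hγ] using continuous_apply γ
  · simpa only [retractTo_of_notMem hγ] using continuous_const

end Retract

/-! ### Finite determination of Lindelöf scattered sets -/

/-- `A` contains the supports of all points produced by `p` from finite lists in `A`. -/
def ClosedUnder {Γ : Type u} {Y : Γ → Type v} (a : ∀ γ, Y γ)
    (p : ℕ → List Γ → ∀ γ, Y γ) (A : Set Γ) : Prop :=
  ∀ n l, (∀ γ ∈ l, γ ∈ A) → diffSupport a (p n l) ⊆ A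

/-- The points of `E` are finitely determined in `X`: there are countably many finitary operations
with values in `X` that produce every retract of a point of `E` to a closed set of coordinates. -/
def FinitelyDetermined {Γ : Type u} {Y : Γ → Type v} (a : ∀ γ, Y γ)
    (X E : Set (∀ γ, Y γ)) : Prop :=
  ∃ p : ℕ → List Γ → ∀ γ, Y γ, (∀ n l, p n l ∈ X) ∧
    ∀ A, ClosedUnder a p A → ∀ x ∈ E, ∃ n l, (∀ γ ∈ l, γ ∈ A) ∧ retractTo a A x = p n l

section Determined

variable {Γ : Type u} {Y : Γ → Type v} {a : ∀ γ, Y γ} {X : Set (∀ γ, Y γ)}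

theorem FinitelyDetermined.mono {E F : Set (∀ γ, Y γ)} (h : FinitelyDetermined a X F)
    (hEF : E ⊆ F) : FinitelyDetermined a X E := by
  obtain ⟨p, hp, h⟩ := h
  exact ⟨p, hp, fun A hA x hx => h A hA x (hEF hx)⟩

theorem FinitelyDetermined.iUnion {E : ℕ → Set (∀ γ, Y γ)}
    (h : ∀ k, FinitelyDetermined a X (E k)) : FinitelyDetermined a X (⋃ k, E k) := by
  choose p hp h using h
  refine ⟨fun n l => p n.unpair.1 n.unpair.2 l, fun n l => hp _ _ _, fun A hA x hx => ?_⟩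
  obtain ⟨k, hk⟩ := mem_iUnion.1 hx
  obtain ⟨n, l, hl, e⟩ := h k A (fun n l hl => by simpa using hA (Nat.pair k n) l hl) x hk
  exact ⟨Nat.pair k n, l, hl, by simpa using e⟩

theorem FinitelyDetermined.biUnion {ι : Type*} {t : Set ι} (ht : t.Countable)
    (hX : X.Nonempty) {E : ι → Set (∀ γ, Y γ)}
    (h : ∀ i ∈ t, FinitelyDetermined a X (E i)) : FinitelyDetermined a X (⋃ i ∈ t, E i) := by
  rcases t.eq_empty_or_nonempty with rfl | hne
  · obtain ⟨x, hx⟩ := hX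
    exact ⟨fun _ _ => x, fun _ _ => hx, by simp⟩
  · obtain ⟨f, rfl⟩ := ht.exists_eq_range hne
    rw [biUnion_range]
    exact FinitelyDetermined.iUnion fun k => h _ (mem_range_self k)

/-- If the retract of `x` to `A` is not `y`, the two differ at some `γ ∈ A`, since `A` contains the
support of `y`. Some `U γ m` then excludes `x γ`, and the operations for that piece apply with `γ`
as an extra argument. -/
theorem FinitelyDetermined.of_separated {E : Set (∀ γ, Y γ)} {y : ∀ γ, Y γ} (hy : y ∈ X)
    {U : ∀ γ, ℕ → Set (Y γ)} (hU : ∀ γ z, z ≠ y γ → ∃ m, z ∉ U γ m)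
    (h : ∀ γ m, FinitelyDetermined a X {x ∈ E | x γ ∉ U γ m}) : FinitelyDetermined a X E := by
  choose p hp h using h
  -- Index `0` is reserved for the constant `y`, which forces closed sets to contain its support.
  -- The head of the list selects the coordinate, and the index codes `m` together with the old
  -- index.
  let q : ℕ → List Γ → ∀ γ, Y γ := fun n l =>
    match n, l with
    | 0, _ => y
    | _ + 1, [] => y
    | n + 1, γ :: l => p γ n.unpair.1 n.unpair.2 l
  refine ⟨q, fun n l => ?_, fun A hA x hx => ?_⟩
  · match n, l with
    | 0, _ => exact hy
    | _ + 1, [] => exact hy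
    | n + 1, γ :: l => exact hp _ _ _ _
  · by_cases hxy : retractTo a A x = y
    · exact ⟨0, [], by simp, hxy⟩
    obtain ⟨γ, hγ⟩ := Function.ne_iff.1 hxy
    have hyA : diffSupport a y ⊆ A := hA 0 [] (by simp)
    have hγA : γ ∈ A := by
      by_contra hγA
      rw [retractTo_of_notMem hγA] at hγ
      exact hγA (hyA (Ne.symm hγ))
    rw [retractTo_of_mem hγA] at hγ
    obtain ⟨m, hm⟩ := hU γ _ hγ
    have hcl : ClosedUnder a (p γ m) A := fun n l hl => by
      have := hA (Nat.pair m n + 1) (γ :: l) (by simpa using ⟨hγA, hl⟩)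
      simpa [q] using this
    obtain ⟨n, l, hl, e⟩ := h γ m A hcl x ⟨hx, hm⟩
    exact ⟨Nat.pair m n + 1, γ :: l, by simpa using ⟨hγA, hl⟩, by simpa [q] using e⟩

theorem finitelyDetermined_of_isClosed [∀ γ, TopologicalSpace (Y γ)] [LindelofSpace X]
    (hX : X.Nonempty) {C : Set X} (hC : IsClosed C)
    (h : ∀ x ∈ C, ∃ N ∈ 𝓝 x, FinitelyDetermined a X (Subtype.val '' N)) :
    FinitelyDetermined a X (Subtype.val '' C) := by
  choose! N hN h using h
  obtain ⟨t, ht, htC, hcov⟩ := hC.isLindelof.elim_nhds_subcover N hN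
  refine (FinitelyDetermined.biUnion ht hX fun x hx => h x (htC x hx)).mono ?_
  rw [← image_iUnion₂]
  exact image_mono hcov

/-- Scatteredness isolates a point `y` among those with no finitely determined neighbourhood. In a
closed neighbourhood of `y` without other bad points, the points that a basic neighbourhood of `y γ`
excludes form a closed set of good points, finitely determined by Lindelöfness. So `y` is good after
all. -/
theorem finitelyDetermined_of_lindelof_scattered [∀ γ, TopologicalSpace (Y γ)]
    [∀ γ, T3Space (Y γ)] [∀ γ, FirstCountableTopology (Y γ)] [LindelofSpace X]
    (hX : X.Nonempty) (hS : IsScatteredSpace X) : FinitelyDetermined a X X := by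
  set B : Set X := {x | ¬ ∃ N ∈ 𝓝 x, FinitelyDetermined a X (Subtype.val '' N)}
  rcases B.eq_empty_or_nonempty with hBe | hBne
  · have := finitelyDetermined_of_isClosed (a := a) hX isClosed_univ fun x _ => by
      by_contra hx
      exact (hBe ▸ (show x ∈ B from hx) : x ∈ (∅ : Set X))
    simpa using this
  exfalso
  obtain ⟨y, hyB, O, hO, hOB⟩ := hS B hBne
  have hyO : y ∈ O := (hOB.ge rfl).1
  obtain ⟨W, hW, hWc, hWO⟩ := exists_mem_nhds_isClosed_subset (hO.mem_nhds hyO)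
  refine hyB ⟨W, hW, ?_⟩
  choose V hV using fun γ => (𝓝 (y.1 γ)).exists_antitone_basis
  refine FinitelyDetermined.of_separated y.2 (U := fun γ m => interior (V γ m)) ?_ ?_
  · intro γ z hz
    obtain ⟨m, hm⟩ := (hV γ).mem_iff.1 (isOpen_compl_singleton.mem_nhds (Ne.symm hz))
    exact ⟨m, fun h => hm (interior_subset h) rfl⟩
  · intro γ m
    have hc : Continuous fun x : X => x.1 γ := (continuous_apply γ).comp continuous_subtype_val
    have hcl : IsClosed {x : X | x ∈ W ∧ x.1 γ ∉ interior (V γ m)} :=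
      hWc.inter ((isOpen_interior.preimage hc).isClosed_compl)
    refine (finitelyDetermined_of_isClosed (a := a) hX hcl fun x hx => ?_).mono ?_
    · by_contra hxB
      have hxy : x = y := by
        have : x ∈ O ∩ B := ⟨hWO hx.1, hxB⟩
        rwa [hOB] at this
      subst hxy
      exact hx.2 (mem_interior_iff_mem_nhds.2 ((hV γ).mem_of_mem trivial))
    · rintro _ ⟨⟨x, hx, rfl⟩, hxm⟩
      exact ⟨x, ⟨hx, hxm⟩, rfl⟩

end Determined

/-! ### Hulls of coordinate sets and their cardinality -/

/-- The smallest set of coordinates that contains `S` and is closed under `p`. -/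
inductive coordHull {Γ : Type u} {Y : Γ → Type v} (a : ∀ γ, Y γ)
    (p : ℕ → List Γ → ∀ γ, Y γ) (S : Set Γ) : Γ → Prop
  | base {γ : Γ} (h : γ ∈ S) : coordHull a p S γ
  | step {γ : Γ} (n : ℕ) (l : List Γ) (hl : ∀ δ ∈ l, coordHull a p S δ)
      (h : p n l γ ≠ a γ) : coordHull a p S γ

section Hull

variable {Γ : Type u} {Y : Γ → Type v} {a : ∀ γ, Y γ} {p : ℕ → List Γ → ∀ γ, Y γ}

theorem closedUnder_coordHull (S : Set Γ) : ClosedUnder a p {γ | coordHull a p S γ} :=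
  fun n l hl _ hγ => coordHull.step n l hl hγ

theorem coordHull_subset {S A : Set Γ} (hA : ClosedUnder a p A) (h : S ⊆ A) :
    {γ | coordHull a p S γ} ⊆ A := by
  intro γ hγ
  induction hγ with
  | base hS => exact h hS
  | step n l _ hne ih => exact hA n l ih hne

theorem coordHull_mono {S T : Set Γ} (h : S ⊆ T) :
    {γ | coordHull a p S γ} ⊆ {γ | coordHull a p T γ} :=
  coordHull_subset (closedUnder_coordHull T) fun _ hγ => coordHull.base (h hγ)

theorem exists_forall_mem_list_of_directed {ι : Type*} [LinearOrder ι] [Nonempty ι] {S : ι → Set Γ}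
    (hS : Monotone S) {l : List Γ} (hl : ∀ γ ∈ l, γ ∈ ⋃ i, S i) :
    ∃ i, ∀ γ ∈ l, γ ∈ S i := by
  induction l with
  | nil => exact ⟨Classical.arbitrary ι, by simp⟩
  | cons γ l ih =>
    obtain ⟨i, hi⟩ := ih fun δ hδ => hl δ (List.mem_cons_of_mem _ hδ)
    obtain ⟨j, hj⟩ := mem_iUnion.1 (hl γ List.mem_cons_self)
    refine ⟨max i j, fun δ hδ => ?_⟩
    rcases List.mem_cons.1 hδ with rfl | hδ
    · exact hS (le_max_right i j) hj
    · exact hS (le_max_left i j) (hi δ hδ)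

theorem closedUnder_iUnion {ι : Type*} [LinearOrder ι] [Nonempty ι] {S : ι → Set Γ}
    (hS : Monotone S) (h : ∀ i, ClosedUnder a p (S i)) : ClosedUnder a p (⋃ i, S i) := by
  intro n l hl
  obtain ⟨i, hi⟩ := exists_forall_mem_list_of_directed hS hl
  exact (h i n l hi).trans (subset_iUnion S i)

open Cardinal in
theorem mk_coordHull_le (hp : ∀ n l, (diffSupport a (p n l)).Countable) (S : Set Γ) :
    #{γ | coordHull a p S γ} ≤ max ℵ₀ #S := by
  -- One round of closure; as arguments are finite lists, `ℕ` many rounds reach a closed set.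
  let g : Set Γ → Set Γ := fun T => T ∪ ⋃ q : ℕ × List T, diffSupport a (p q.1 (q.2.map (↑)))
  let T : ℕ → Set Γ := fun k => g^[k] S
  have hsucc : ∀ k, T (k + 1) = g (T k) := fun k => Function.iterate_succ_apply' g k S
  have hmono : Monotone T := monotone_nat_of_le_succ fun k => by
    rw [hsucc]
    exact subset_union_left
  have hcard : ∀ k, #(T k) ≤ max ℵ₀ #S := by
    intro k
    induction k with
    | zero => exact le_max_right _ _
    | succ k ih =>
      rw [hsucc]
      have hc : ℵ₀ ≤ max ℵ₀ #S := le_max_left _ _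
      refine (mk_union_le _ _).trans (add_le_of_le hc ih ?_)
      refine (mk_iUnion_le _).trans (mul_le_of_le hc ?_ (ciSup_le' fun q => ?_))
      · rw [mk_prod, mk_nat, lift_aleph0, lift_uzero]
        exact mul_le_of_le hc hc ((mk_list_le_max _).trans (max_le hc ih))
      · exact (le_aleph0_iff_set_countable.2 (hp _ _)).trans hc
  have hcl : ClosedUnder a p (⋃ k, T k) := by
    intro n l hl
    obtain ⟨k, hk⟩ := exists_forall_mem_list_of_directed hmono hl
    refine subset_trans ?_ (subset_iUnion T (k + 1))
    rw [hsucc]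
    lift l to List (T k) using hk
    exact subset_union_of_subset_right
      (subset_iUnion (fun q : ℕ × List (T k) => diffSupport a (p q.1 (q.2.map (↑)))) (n, l)) _
  refine (mk_le_mk_of_subset (coordHull_subset hcl (subset_iUnion T 0))).trans ?_
  have h := mk_iUnion_le_lift T
  simp only [mk_nat, lift_aleph0, lift_uzero] at h
  exact h.trans (mul_le_of_le (le_max_left _ _) (le_max_left _ _) (ciSup_le' hcard))

end Hull

/-! ### Gluing compact sets along a continuous chain -/

/-- The points of `X` whose support is contained in `A`. -/
def supportedIn {Γ : Type u} {Y : Γ → Type v} (a : ∀ γ, Y γ) (X : Set (∀ γ, Y γ))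
    (A : Set Γ) : Set (∀ γ, Y γ) :=
  {x ∈ X | diffSupport a x ⊆ A}

/-- The compact sets attached to a chain `B` of sets of coordinates and to compact exhaustions
`Z β` of the points supported in `B β`. A point of level `n + 1` that first appears at a successor
stage `δ + 1` has a retract to `B δ` of level `n`. -/
def chainCompact {Γ : Type u} {Y : Γ → Type v} (a : ∀ γ, Y γ) (B : Ordinal.{u} → Set Γ)
    (Z : Ordinal.{u} → ℕ → Set (∀ γ, Y γ)) (o : Ordinal.{u}) : ℕ → Set (∀ γ, Y γ)
  | 0 => ∅
  | n + 1 => {x | x ∈ Z 0 n ∨ ∃ δ < o, x ∈ Z (δ + 1) n ∧ ¬ diffSupport a x ⊆ B δ ∧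
      retractTo a (B δ) x ∈ chainCompact a B Z o n}

section Chain

variable {Γ : Type u} {Y : Γ → Type v} {a : ∀ γ, Y γ} {X : Set (∀ γ, Y γ)}
  {B : Ordinal.{u} → Set Γ} {Z : Ordinal.{u} → ℕ → Set (∀ γ, Y γ)} {o : Ordinal.{u}}

theorem chainCompact_subset_succ (hZ : ∀ β, Monotone (Z β)) (n : ℕ) :
    chainCompact a B Z o n ⊆ chainCompact a B Z o (n + 1) := by
  induction n with
  | zero => exact empty_subset _
  | succ n ih =>
    rintro x (hx | ⟨δ, hδ, hx, hne, hr⟩)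
    · exact Or.inl (hZ 0 n.le_succ hx)
    · exact Or.inr ⟨δ, hδ, hZ _ n.le_succ hx, hne, ih hr⟩

theorem chainCompact_subset (hB : Monotone B) (ho : Order.IsSuccLimit o)
    (hZX : ∀ β < o, ∀ n, Z β n ⊆ supportedIn a X (B β)) (n : ℕ) :
    chainCompact a B Z o n ⊆ supportedIn a X (B o) := by
  have key : ∀ β < o, ∀ n, Z β n ⊆ supportedIn a X (B o) := fun β hβ n x hx =>
    ⟨(hZX β hβ n hx).1, (hZX β hβ n hx).2.trans (hB hβ.le)⟩
  cases n with
  | zero => exact empty_subset _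
  | succ n =>
    rintro x (hx | ⟨δ, hδ, hx, -, -⟩)
    · exact key 0 ho.bot_lt n hx
    · exact key _ (ho.add_one_lt hδ) n hx

/-- Any proper retraction along the chain lowers the level: it factors through the retraction to the
stage `B δ` just before `x` appears, which lowers it by definition. -/
theorem retractTo_mem_chainCompact (hB : Monotone B) (ho : Order.IsSuccLimit o)
    (hZ : ∀ β, Monotone (Z β)) (hZX : ∀ β < o, ∀ n, Z β n ⊆ supportedIn a X (B β)) (n : ℕ)
    {x : ∀ γ, Y γ} (hx : x ∈ chainCompact a B Z o (n + 1)) {β : Ordinal.{u}}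
    (hβ : ¬ diffSupport a x ⊆ B β) : retractTo a (B β) x ∈ chainCompact a B Z o n := by
  induction n generalizing x with
  | zero =>
    rcases hx with hx | ⟨δ, hδ, hx, hne, hr⟩
    · exact absurd ((hZX 0 ho.bot_lt _ hx).2.trans (hB zero_le)) hβ
    · exact hr.elim
  | succ n ih =>
    rcases hx with hx | ⟨δ, hδ, hx, hne, hr⟩
    · exact absurd ((hZX 0 ho.bot_lt _ hx).2.trans (hB zero_le)) hβ
    have hβδ : β ≤ δ := by
      by_contra! h
      exact hβ ((hZX _ (ho.add_one_lt hδ) _ hx).2.trans (hB (Order.add_one_le_of_lt h)))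
    rw [← retractTo_retractTo (hB hβδ)]
    by_cases hs : diffSupport a (retractTo a (B δ) x) ⊆ B β
    · rwa [retractTo_eq_self hs]
    · exact chainCompact_subset_succ hZ n (ih hr hs)

/-- For an ultrafilter on level `n + 1`, take the least stage `β` supporting almost every point. A
limit point comes from `Z 0 n` at zero, from `Z (δ + 1) n` at a successor, and from compactness of
level `n` at a limit. -/
theorem isCompact_chainCompact [∀ γ, TopologicalSpace (Y γ)] [∀ γ, T2Space (Y γ)]
    (hB : Monotone B) (hBl : ∀ l, Order.IsSuccLimit l → B l ⊆ ⋃ β : Iio l, B β)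
    (ho : Order.IsSuccLimit o) (hZ : ∀ β, Monotone (Z β)) (hZc : ∀ β < o, ∀ n, IsCompact (Z β n))
    (hZX : ∀ β < o, ∀ n, Z β n ⊆ supportedIn a X (B β)) (n : ℕ) :
    IsCompact (chainCompact a B Z o n) := by
  induction n with
  | zero => exact isCompact_empty
  | succ n ih =>
    rw [isCompact_iff_ultrafilter_le_nhds]
    intro 𝒰 h𝒰
    rw [le_principal_iff] at h𝒰
    let Q : Set Ordinal.{u} := {β | {x | diffSupport a x ⊆ B β} ∈ 𝒰}
    have hoQ : o ∈ Q :=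
      mem_of_superset h𝒰 fun x hx => (chainCompact_subset hB ho hZX (n + 1) hx).2
    obtain ⟨β, hβQ, hmin⟩ : ∃ β ∈ Q, ∀ δ < β, δ ∉ Q :=
      ⟨sInf Q, csInf_mem ⟨o, hoQ⟩, fun δ hδ => notMem_of_lt_csInf' hδ⟩
    have hβo : β ≤ o := not_lt.1 fun h => hmin o h hoQ
    have hmin' : ∀ δ < β, {x | ¬ diffSupport a x ⊆ B δ} ∈ 𝒰 := fun δ hδ =>
      Ultrafilter.compl_mem_iff_notMem.2 (hmin δ hδ)
    rcases Ordinal.zero_or_succ_or_isSuccLimit β with rfl | ⟨δ, rfl⟩ | hlim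
    · have hmem : Z 0 n ∈ 𝒰 := by
        filter_upwards [h𝒰, hβQ] with x hx hs
        rcases hx with hx | ⟨δ, hδ, hx, hne, hr⟩
        · exact hx
        · exact absurd (hs.trans (hB zero_le)) hne
      obtain ⟨y, hy, hle⟩ := isCompact_iff_ultrafilter_le_nhds.1 (hZc 0 ho.bot_lt n) 𝒰
        (le_principal_iff.2 hmem)
      exact ⟨y, Or.inl hy, hle⟩
    · rw [Order.succ_eq_add_one] at *
      have hδo : δ < o := (lt_add_one δ).trans_le hβo
      -- Almost every point first appears exactly at stage `δ + 1`, so the witness `ε` in its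
      -- membership must be `δ`.
      have hmem : Z (δ + 1) n ∩ retractTo a (B δ) ⁻¹' chainCompact a B Z o n ∈ 𝒰 := by
        filter_upwards [h𝒰, hβQ, hmin' δ (lt_add_one δ)] with x hx hs hne
        rcases hx with hx | ⟨ε, hε, hx, hne', hr⟩
        · exact absurd ((hZX 0 ho.bot_lt _ hx).2.trans (hB zero_le)) hne
        · have h1 : δ ≤ ε := by
            by_contra! h
            exact hne ((hZX _ (ho.add_one_lt hε) _ hx).2.trans (hB (Order.add_one_le_of_lt h)))
          have h2 : ε ≤ δ := by
            by_contra! h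
            exact hne' (hs.trans (hB (Order.add_one_le_of_lt h)))
          obtain rfl := le_antisymm h1 h2
          exact ⟨hx, hr⟩
      have hc := (hZc _ (ho.add_one_lt hδo) n).inter_right
        (ih.isClosed.preimage (continuous_retractTo (a := a) (B δ)))
      obtain ⟨y, hy, hle⟩ := isCompact_iff_ultrafilter_le_nhds.1 hc 𝒰 (le_principal_iff.2 hmem)
      refine ⟨y, ?_, hle⟩
      -- The support may shrink in the limit; then `y` is its own retract and lies in level `n`.
      by_cases hs : diffSupport a y ⊆ B δ
      · have := hy.2
        rw [mem_preimage, retractTo_eq_self hs] at this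
        exact chainCompact_subset_succ hZ n this
      · exact Or.inr ⟨δ, hδo, hy.1, hs, hy.2⟩
    -- Each coordinate in `B β` lies in an earlier `B δ`, where the retracts converge inside level
    -- `n`. The limit `y` is in turn the limit of its own retracts, so it already lies in level `n`.
    · have hr : ∀ δ < β, {x | retractTo a (B δ) x ∈ chainCompact a B Z o n} ∈ 𝒰 := by
        intro δ hδ
        filter_upwards [h𝒰, hmin' δ hδ] with x hx hne
        exact retractTo_mem_chainCompact hB ho hZ hZX n hx hne
      have hcoord : ∀ γ, ∃ z, Tendsto (fun x : ∀ γ, Y γ => x γ) 𝒰 (𝓝 z) := by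
        intro γ
        by_cases hγ : γ ∈ B β
        · obtain ⟨⟨δ, hδ⟩, hγδ⟩ := mem_iUnion.1 (hBl β hlim hγ)
          obtain ⟨w, -, hw⟩ := isCompact_iff_ultrafilter_le_nhds.1 ih
            (𝒰.map (retractTo a (B δ))) (le_principal_iff.2 (hr δ hδ))
          refine ⟨w γ, ?_⟩
          have := ((continuous_apply γ).tendsto w).comp
            (show Tendsto (retractTo a (B δ)) 𝒰 (𝓝 w) from hw)
          exact this.congr fun x => retractTo_of_mem hγδ x
        · refine ⟨a γ, tendsto_const_nhds.congr' ?_⟩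
          filter_upwards [hβQ] with x hs
          by_contra hne
          exact hγ (hs (Ne.symm hne))
      choose y hy using hcoord
      have hle : (𝒰 : Filter (∀ γ, Y γ)) ≤ 𝓝 y := tendsto_pi_nhds.2 hy
      refine ⟨y, chainCompact_subset_succ hZ n ?_, hle⟩
      have hry : ∀ δ < β, retractTo a (B δ) y ∈ chainCompact a B Z o n := fun δ hδ =>
        ih.isClosed.mem_of_tendsto
          (((continuous_retractTo (a := a) (B δ)).tendsto y).mono_left hle) (hr δ hδ)
      have : Nonempty (Iio β) := ⟨⟨0, hlim.bot_lt⟩⟩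
      have hconv : Tendsto (fun δ : Iio β => retractTo a (B δ) y) atTop (𝓝 y) := by
        refine tendsto_pi_nhds.2 fun γ => tendsto_const_nhds.congr' ?_
        by_cases hγ : γ ∈ B β
        · obtain ⟨δ, hγδ⟩ := mem_iUnion.1 (hBl β hlim hγ)
          filter_upwards [eventually_ge_atTop δ] with ε hε
          exact (retractTo_of_mem (hB hε hγδ) y).symm
        · have hya : y γ = a γ := by
            refine tendsto_nhds_unique (hy γ) (tendsto_const_nhds.congr' ?_)
            filter_upwards [hβQ] with x hs
            by_contra hne
            exact hγ (hs (Ne.symm hne))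
          refine Eventually.of_forall fun δ => ?_
          exact hya.trans (retractTo_of_notMem (fun h => hγ (hB (le_of_lt δ.2) h)) y).symm
      exact ih.isClosed.mem_of_tendsto hconv (Eventually.of_forall fun δ => hry δ δ.2)

theorem exists_mem_chainCompact (ho : Order.IsSuccLimit o)
    (hX : ∀ β, ∀ x ∈ X, retractTo a (B β) x ∈ X)
    (hlim : ∀ l, Order.IsSuccLimit l → ∀ x ∈ supportedIn a X (B l), ∃ β < l,
      x ∈ supportedIn a X (B β))
    (hZ : ∀ β, Monotone (Z β)) (hZX : ∀ β < o, ⋃ n, Z β n = supportedIn a X (B β))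
    {x : ∀ γ, Y γ} (hx : x ∈ supportedIn a X (B o)) : ∃ n, x ∈ chainCompact a B Z o n := by
  have hmono : Monotone (chainCompact a B Z o) :=
    monotone_nat_of_le_succ (chainCompact_subset_succ hZ)
  have key : ∀ β < o, ∀ x ∈ supportedIn a X (B β), ∃ n, x ∈ chainCompact a B Z o n := by
    intro β
    induction β using WellFoundedLT.induction with
    | ind β ih =>
      intro hβ x hx
      rcases Ordinal.zero_or_succ_or_isSuccLimit β with rfl | ⟨δ, rfl⟩ | hl
      · rw [← hZX 0 hβ] at hx
        obtain ⟨n, hn⟩ := mem_iUnion.1 hx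
        exact ⟨n + 1, Or.inl hn⟩
      · rw [Order.succ_eq_add_one] at *
        have hδ : δ < δ + 1 := lt_add_one δ
        by_cases hs : diffSupport a x ⊆ B δ
        · exact ih δ hδ (hδ.trans hβ) x ⟨hx.1, hs⟩
        obtain ⟨n, hn⟩ := ih δ hδ (hδ.trans hβ) _
          ⟨hX δ x hx.1, diffSupport_retractTo_subset (B δ) x⟩
        rw [← hZX _ hβ] at hx
        obtain ⟨m, hm⟩ := mem_iUnion.1 hx
        exact ⟨max n m + 1, Or.inr ⟨δ, hδ.trans hβ, hZ _ (le_max_right n m) hm, hs,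
          hmono (le_max_left n m) hn⟩⟩
      · obtain ⟨δ, hδ, hxδ⟩ := hlim β hl x hx
        exact ih δ hδ (hδ.trans hβ) x hxδ
  obtain ⟨β, hβ, hxβ⟩ := hlim o ho x hx
  exact key β hβ x hxβ

theorem isSigmaCompact_supportedIn_of_chain [∀ γ, TopologicalSpace (Y γ)] [∀ γ, T2Space (Y γ)]
    (hB : Monotone B) (hBl : ∀ l, Order.IsSuccLimit l → B l ⊆ ⋃ β : Iio l, B β)
    (ho : Order.IsSuccLimit o) (hX : ∀ β, ∀ x ∈ X, retractTo a (B β) x ∈ X)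
    (hlim : ∀ l, Order.IsSuccLimit l → ∀ x ∈ supportedIn a X (B l), ∃ β < l,
      x ∈ supportedIn a X (B β))
    (hσ : ∀ β < o, IsSigmaCompact (supportedIn a X (B β))) :
    IsSigmaCompact (supportedIn a X (B o)) := by
  choose! K hK hKX using hσ
  let Z : Ordinal.{u} → ℕ → Set (∀ γ, Y γ) := fun β => accumulate (K β)
  have hZ : ∀ β, Monotone (Z β) := fun β => monotone_accumulate
  have hZc : ∀ β < o, ∀ n, IsCompact (Z β n) := fun β hβ n => isCompact_accumulate (hK β hβ) n
  have hZX : ∀ β < o, ⋃ n, Z β n = supportedIn a X (B β) := fun β hβ =>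
    iUnion_accumulate.trans (hKX β hβ)
  have hZX' : ∀ β < o, ∀ n, Z β n ⊆ supportedIn a X (B β) := fun β hβ n =>
    (hZX β hβ) ▸ subset_iUnion (Z β) n
  refine ⟨chainCompact a B Z o, isCompact_chainCompact hB hBl ho hZ hZc hZX', ?_⟩
  refine Subset.antisymm (iUnion_subset (chainCompact_subset hB ho hZX')) fun x hx => ?_
  exact mem_iUnion.2 (exists_mem_chainCompact ho hX hlim hZ hZX hx)

end Chain

/-! ### Induction on the cardinality of the coordinate set -/

section Induction

variable {Γ : Type u} {Y : Γ → Type v} {a : ∀ γ, Y γ} {X : Set (∀ γ, Y γ)}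
  {p : ℕ → List Γ → ∀ γ, Y γ}

theorem countable_supportedIn {A : Set Γ} (hA : A.Countable)
    (h : ∀ x ∈ X, ∃ n l, (∀ γ ∈ l, γ ∈ A) ∧ retractTo a A x = p n l) :
    (supportedIn a X A).Countable := by
  have := hA.to_subtype
  refine (countable_range fun q : ℕ × List A => p q.1 (q.2.map (↑))).mono ?_
  rintro x ⟨hx, hs⟩
  obtain ⟨n, l, hl, e⟩ := h x hx
  rw [retractTo_eq_self hs] at e
  lift l to List A using hl
  exact ⟨(n, l), e.symm⟩

theorem IsSigmaCompact.of_countable {T : Type*} [TopologicalSpace T] {s : Set T}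
    (hs : s.Countable) : IsSigmaCompact s := by
  rw [← biUnion_of_singleton s]
  exact isSigmaCompact_biUnion hs fun x _ => isCompact_singleton.isSigmaCompact

open Cardinal in
theorem isSigmaCompact_supportedIn [∀ γ, TopologicalSpace (Y γ)] [∀ γ, T2Space (Y γ)]
    (hp : ∀ n l, p n l ∈ X) (hsupp : ∀ n l, (diffSupport a (p n l)).Countable)
    (h : ∀ A, ClosedUnder a p A → ∀ x ∈ X, ∃ n l, (∀ γ ∈ l, γ ∈ A) ∧ retractTo a A x = p n l)
    (A : Set Γ) (hA : ClosedUnder a p A) : IsSigmaCompact (supportedIn a X A) := by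
  induction hκ : #A using WellFoundedLT.induction generalizing A with
  | ind κ ih =>
    subst hκ
    rcases le_or_gt #A ℵ₀ with hc | hc
    · exact IsSigmaCompact.of_countable
        (countable_supportedIn (le_aleph0_iff_set_countable.1 hc) (h A hA))
    obtain ⟨r, hr, hord⟩ := exists_ord_eq A
    -- Well-ordering `A` in its least order type gives proper initial segments of smaller
    -- cardinality; as `A` is uncountable, their hulls stay smaller too.
    let seg : Ordinal.{u} → Set Γ := fun β => (↑) '' {x : A | Ordinal.typein r x < β}
    have hseg : Monotone seg := fun β δ hβδ =>
      image_mono fun _ hx => (mem_ofPred.1 hx).trans_le hβδ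
    have hsegA : seg (#A).ord = A := by
      have : {x : A | Ordinal.typein r x < (#A).ord} = Set.univ :=
        eq_univ_of_forall fun x => by
          rw [mem_ofPred_eq, hord]
          exact Ordinal.typein_lt_type r x
      simp [seg, this]
    have hsegcard : ∀ β < (#A).ord, #(seg β) < #A := by
      intro β hβ
      refine lt_of_le_of_lt ?_ (lt_ord.1 hβ)
      rw [mk_image_eq Subtype.val_injective]
      have hinj : Function.Injective fun x : {x : A | Ordinal.typein r x < β} =>
          (⟨Ordinal.typein r x.1, x.2⟩ : Iio β) := fun x y hxy =>
        Subtype.ext (Ordinal.typein_injective r (congrArg Subtype.val hxy))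
      have := mk_le_of_injective (α := ULift.{u + 1} {x : A | Ordinal.typein r x < β})
        (hinj.comp ULift.down_injective)
      rw [mk_uLift, mk_Iio_ordinal] at this
      exact lift_le.1 this
    let B : Ordinal.{u} → Set Γ := fun β => {γ | coordHull a p (seg β) γ}
    have hB : Monotone B := fun β δ hβδ => coordHull_mono (hseg hβδ)
    have hBcl : ∀ β, ClosedUnder a p (B β) := fun β => closedUnder_coordHull (seg β)
    have hBo : B (#A).ord = A := by
      refine Subset.antisymm (coordHull_subset hA hsegA.le) fun γ hγ => coordHull.base ?_
      rwa [hsegA]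
    have hBl : ∀ l, Order.IsSuccLimit l → B l ⊆ ⋃ β : Iio l, B β := by
      intro l hl
      have : Nonempty (Iio l) := ⟨⟨0, hl.bot_lt⟩⟩
      refine coordHull_subset (closedUnder_iUnion (fun β δ hβδ => hB hβδ) fun β => hBcl β) ?_
      rintro _ ⟨x, hx, rfl⟩
      -- Segments are strict, so `x` enters one stage after its rank, still below the limit `l`.
      refine mem_iUnion.2 ⟨⟨Ordinal.typein r x + 1, hl.add_one_lt hx⟩, coordHull.base ?_⟩
      exact ⟨x, mem_ofPred.2 (lt_add_one _), rfl⟩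
    have hX : ∀ β, ∀ x ∈ X, retractTo a (B β) x ∈ X := by
      intro β x hx
      obtain ⟨n, l, -, e⟩ := h (B β) (hBcl β) x hx
      exact e ▸ hp n l
    have hlim : ∀ l, Order.IsSuccLimit l → ∀ x ∈ supportedIn a X (B l), ∃ β < l,
        x ∈ supportedIn a X (B β) := by
      rintro l hl x ⟨hx, hs⟩
      have : Nonempty (Iio l) := ⟨⟨0, hl.bot_lt⟩⟩
      obtain ⟨n, q, hq, e⟩ := h (B l) (hBcl l) x hx
      rw [retractTo_eq_self hs] at e
      obtain ⟨β, hβ⟩ := exists_forall_mem_list_of_directed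
        (S := fun β : Iio l => B β) (fun β δ hβδ => hB hβδ) fun γ hγ => hBl l hl (hq γ hγ)
      -- The finite list `q` producing `x` lies in some `B β`, whose closedness puts the whole
      -- support of `x` there.
      exact ⟨β, β.2, hx, e ▸ hBcl β n q hβ⟩
    rw [← hBo]
    refine isSigmaCompact_supportedIn_of_chain hB hBl (isSuccLimit_ord hc.le) hX hlim
      fun β hβ => ih #(B β) ?_ (B β) (hBcl β) rfl
    exact (mk_coordHull_le hsupp (seg β)).trans_lt (max_lt hc (hsegcard β hβ))

end Induction

/-- A subspace of the `Σ`-product is given as a set `X` of points of the full product that is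
contained in the `Σ`-product; `X` carries the subspace topology of the product topology. -/
theorem theorem1 {Γ : Type*} {Y : Γ → Type*} [∀ γ, TopologicalSpace (Y γ)]
    [∀ γ, T35Space (Y γ)] [∀ γ, FirstCountableTopology (Y γ)] (a : ∀ γ, Y γ)
    (X : Set (∀ γ, Y γ)) (hX : X ⊆ sigmaProduct a)
    (hLindelof : LindelofSpace X) (hScattered : IsScatteredSpace X) :
    SigmaCompactSpace X := by
  rw [← isSigmaCompact_iff_sigmaCompactSpace]
  rcases X.eq_empty_or_nonempty with rfl | hne
  · exact isSigmaCompact_empty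
  obtain ⟨p, hp, h⟩ := finitelyDetermined_of_lindelof_scattered (a := a) hne hScattered
  have := isSigmaCompact_supportedIn hp (fun n l => hX (hp n l)) h univ
    fun _ _ _ => subset_univ _
  simpa [supportedIn] using this
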